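/- For $\rho\in\mathbb C$ with $\operatorname{Re}\rho>0$, $m\in\mathbb N=\{1,2,\dots\}$, $u,v\in\mathbb C$ and $\omega>0$ let $$\mathcal M_{\rho,m}[f(x)](u,v,\omega)=\int_0^\infty\frac{e^{-ux-v/x}}{(x^m+\omega^m)^{\rho}}\,f(\omega x)\,dx .$$ For $\operatorname{Re}b\ge 0$ and $\operatorname{Re}z>0$ let $\Gamma_b(z)=\int_0^\infty t^{z-1}e^{-t-b/t}\,dt$ be the extended gamma function (so $\Gamma_0=\Gamma$), and define the extended $H$-function by the Mellin–Barnes integral $$H^{2,1}_{1,2}\left[z\,\middle|\begin{array}{l}(\mathsf a,\alpha)\\(b_1,\beta_1)_b,(b_2,\beta_2)\end{array}\right]=\frac1{2\pi i}\int_{c-i\infty}^{c+i\infty}\Gamma(1-\mathsf a-\alpha t)\,\Gamma_b(b_1+\beta_1t)\,\Gamma(b_2+\beta_2t)\,z^{-t}\,dt ,$$ where $c\in\mathbb R$ is any number such that the arguments of the three gamma factors have positive real part on the line $\operatorname{Re}t=c$, and complex powers take their principal values. Let $\operatorname{Re}\rho>0$, $m\in\mathbb N$, $\lambda>0$, $a\ge0$,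 $\omega>0$ and $u,v\in\mathbb C$ with $\operatorname{Re}v\ge0$. (i) If $\operatorname{Re}u>0$ and $\operatorname{Re}(uv)\ge0$, then $$\mathcal M_{\rho,m}[x^{\lambda-1}](u,v,\omega)=\frac{\omega^{\lambda-m\rho-1}u^{-\lambda}}{m\,\Gamma(\rho)}\,H^{2,1}_{1,2}\left[u\omega\,\middle|\begin{array}{l}(1,\frac1m)\\(\lambda,1)_{uv},(\rho,\frac1m)\end{array}\right].$$ (ii) If $\operatorname{Re}(u+a\omega)>0$ and $\operatorname{Re}((u+a\omega)v)\ge0$, then $$\mathcal M_{\rho,m}[e^{-ax}](u,v,\omega)=\frac{\omega^{-m\rho}}{m\,(u+a\omega)\,\Gamma(\rho)}\,H^{2,1}_{1,2}\left[\omega(u+a\omega)\,\middle|\begin{array}{l}(1,\frac1m)\\(1,1)_{(u+a\omega)v},(\rho,\frac1m)\end{array}\right].$$ (iii) Under the conditions of (ii), $$\mathcal M_{\rho,m}[x^{\lambda-1}e^{-ax}](u,v,\omega)=\frac{\omega^{\lambda-m\rho-1}}{m\,(u+a\omega)^{\lambda}\,\Gamma(\rho)}\,H^{2,1}_{1,2}\left[\omega(u+a\omega)\,\middle|\begin{array}{l}(1,\frac1m)\\(\lambda,1)_{(u+a\omega)v},(\rho,\frac1m)\end{array}\right].$$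 In each case admissible $c$ exist, the integrals defining $\mathcal M_{\rho,m}$ and $H^{2,1}_{1,2}$ converge absolutely, and the identity holds for every admissible $c$. -/

import Mathlib

open MeasureTheory Set

noncomputable section

/-- The integrand `e^{-ux-v/x} (x^m + ω^m)^{-ρ} f(ωx)` of the `𝓜`-transform. -/
def mIntegrand (ρ : ℂ) (m : ℕ) (f : ℝ → ℂ) (u v : ℂ) (ω : ℝ) (x : ℝ) : ℂ :=
  Complex.exp (-u * (x : ℂ) - v / (x : ℂ)) / ((x ^ m + ω ^ m : ℝ) : ℂ) ^ ρ * f (ω * x)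

/-- The `𝓜`-transform `𝓜_{ρ,m}[f](u,v,ω) = ∫₀^∞ e^{-ux-v/x} (x^m + ω^m)^{-ρ} f(ωx) dx`. -/
def mTransform (ρ : ℂ) (m : ℕ) (f : ℝ → ℂ) (u v : ℂ) (ω : ℝ) : ℂ :=
  ∫ x in Ioi (0 : ℝ), mIntegrand ρ m f u v ω x

/-- The extended gamma function `Γ_b(z) = ∫₀^∞ t^{z-1} e^{-t-b/t} dt`; the integral converges
absolutely for `Re z > 0` and `Re b ≥ 0`, and `Γ_0 = Γ` on `Re z > 0`. -/
def extGamma (b z : ℂ) : ℂ :=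
  ∫ t in Ioi (0 : ℝ), (t : ℂ) ^ (z - 1) * Complex.exp (-(t : ℂ) - b / (t : ℂ))

/-- The integrand `Γ(1-a-αt) Γ_b(b₁+β₁t) Γ(b₂+β₂t) z^{-t}` of the extended `H`-function. -/
def extHIntegrand (a : ℂ) (α : ℝ) (b₁ : ℂ) (β₁ : ℝ) (b₂ : ℂ) (β₂ : ℝ) (b z t : ℂ) : ℂ :=
  Complex.Gamma (1 - a - α * t) * extGamma b (b₁ + β₁ * t) * Complex.Gamma (b₂ + β₂ * t)
    * z ^ (-t)

/-- The abscissas `c` of the lines `Re t = c` that are Mellin–Barnes contours for the extended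
`H`-function: the arguments of the three gamma factors have positive real part on the line, so
that it has the poles of `Γ(1-a-αt)` on one side and those of `Γ(b₂+β₂t)` on the other, and
`Γ_b(b₁+β₁t)` is given by its integral. -/
def IsExtHAbscissa (a : ℂ) (α : ℝ) (b₁ : ℂ) (β₁ : ℝ) (b₂ : ℂ) (β₂ : ℝ) (c : ℝ) : Prop :=
  0 < 1 - a.re - α * c ∧ 0 < b₁.re + β₁ * c ∧ 0 < b₂.re + β₂ * c

/-- The extended `H`-function `H^{2,1}_{1,2}[z; b | (a,α); (b₁,β₁)_b, (b₂,β₂)]`, as the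
Mellin–Barnes integral `(1/2πi) ∫ Γ(1-a-αt) Γ_b(b₁+β₁t) Γ(b₂+β₂t) z^{-t} dt` along the upward
line `t = c + iy`, so that `dt = i dy`. -/
def extH (c : ℝ) (a : ℂ) (α : ℝ) (b₁ : ℂ) (β₁ : ℝ) (b₂ : ℂ) (β₂ : ℝ) (b z : ℂ) : ℂ :=
  1 / (2 * (Real.pi : ℂ) * Complex.I) *
    ∫ y : ℝ, extHIntegrand a α b₁ β₁ b₂ β₂ b z ((c : ℂ) + (y : ℂ) * Complex.I) * Complex.I

end

/-! Since `f(ωx)` contributes only powers and `e^{-aωx}`, everything reduces, with `s = u + aω`, to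
the integral of `x^{λ-1} e^{-sx-v/x} (x^m+ω^m)^{-ρ}`. Two facts evaluate it.

The first is the Mellin–Barnes formula for `(1+X)^{-ρ}`: the beta integral gives its Mellin
transform `Γ(σ)Γ(ρ-σ)/Γ(ρ)`, and Mellin inversion applies (`integral_gamma_mul_gamma_mul_cpow`).
Putting `X = (x/ω)^m` and `σ = -t/m` produces `Γ(-t/m) Γ(ρ+t/m) (x/ω)^t`.

The second is the rotation `∫ x^{z-1} e^{-sx-v/x} dx = s^{-z} Γ_{sv}(z)` (`mellin_expAddDiv`). For
`s > 0` it is a substitution; the identity theorem carries it to complex `s`, and a limit reaches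
the closed conditions on `v` and `sv`.

Fubini in `(x, t)` joins the two at `z = λ + t` (`verticalIntegrable_and_integral_eq`) and also
yields absolute convergence of the `H`-integral, so no decay estimate for `Γ_b` is needed. -/

/-! ### The kernel `e^{-px-q/x}` and its Mellin transform. -/

theorem integrableOn_rpow_mul_exp_neg_mul {p s : ℝ} (hp : 0 < p) (hs : 0 < s) :
    IntegrableOn (fun x : ℝ => x ^ (s - 1) * Real.exp (-(p * x))) (Ioi 0) := by
  have := integrableOn_rpow_mul_exp_neg_mul_rpow (s := s - 1) (b := p) (p := 1) (by linarith)
    one_pos hp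
  simpa using this

/-- The exponential `e^{-px-q/x}`, whose Mellin transform is of Bessel type. -/
noncomputable def expAddDiv (p q : ℂ) (x : ℝ) : ℂ := Complex.exp (-p * x - q / x)

theorem measurable_expAddDiv (p q : ℂ) : Measurable (expAddDiv p q) := by
  unfold expAddDiv; fun_prop

theorem norm_expAddDiv (p q : ℂ) (x : ℝ) :
    ‖expAddDiv p q x‖ = Real.exp (-(p.re * x) - q.re / x) := by
  rw [expAddDiv, Complex.norm_exp]
  simp [Complex.div_ofReal_re]

theorem norm_expAddDiv_le {p q : ℂ} (hq : 0 ≤ q.re) {x : ℝ} (hx : 0 < x) :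
    ‖expAddDiv p q x‖ ≤ Real.exp (-(p.re * x)) := by
  rw [norm_expAddDiv]
  have : 0 ≤ q.re / x := by positivity
  exact Real.exp_le_exp.2 (by linarith)

theorem aestronglyMeasurable_cpow_mul_expAddDiv (p q z : ℂ) (μ : Measure ℝ) :
    AEStronglyMeasurable (fun x : ℝ => (x : ℂ) ^ (z - 1) * expAddDiv p q x) μ :=
  ((Complex.measurable_ofReal.pow_const _).mul (measurable_expAddDiv p q)).aestronglyMeasurable

theorem norm_cpow_mul_expAddDiv_le {p q z : ℂ} (hq : 0 ≤ q.re) {x : ℝ} (hx : 0 < x) :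
    ‖(x : ℂ) ^ (z - 1) * expAddDiv p q x‖ ≤ x ^ (z.re - 1) * Real.exp (-(p.re * x)) := by
  rw [norm_mul, Complex.norm_cpow_eq_rpow_re_of_pos hx, Complex.sub_re, Complex.one_re]
  exact mul_le_mul_of_nonneg_left (norm_expAddDiv_le hq hx) (by positivity)

theorem mellinConvergent_expAddDiv {p q z : ℂ} (hp : 0 < p.re) (hq : 0 ≤ q.re) (hz : 0 < z.re) :
    MellinConvergent (expAddDiv p q) z := by
  refine (integrableOn_rpow_mul_exp_neg_mul hp hz).mono'
    (aestronglyMeasurable_cpow_mul_expAddDiv p q z _) ?_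
  filter_upwards [ae_restrict_mem measurableSet_Ioi] with x hx
  exact norm_cpow_mul_expAddDiv_le hq hx

theorem extGamma_eq_mellin (b z : ℂ) : extGamma b z = mellin (expAddDiv 1 b) z := by
  simp [extGamma, mellin, expAddDiv]

/-! ### Holomorphy in the parameter and contour rotation. -/

theorem exp_neg_div_le (n : ℕ) {δ x : ℝ} (hδ : 0 < δ) (hx : 0 < x) :
    Real.exp (-(δ / x)) ≤ n.factorial / δ ^ n * x ^ n := by
  have h := Real.pow_div_factorial_le_exp (δ / x) (by positivity) n
  rw [Real.exp_neg]
  have h2 : ((δ / x) ^ n / n.factorial)⁻¹ = n.factorial / δ ^ n * x ^ n := by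
    rw [div_pow]; field_simp
  rw [← h2]
  exact inv_anti₀ (by positivity) h

/-- Rapid decay of `e^{-δ/x}` at `0` makes every power integrable. -/
theorem integrableOn_rpow_mul_exp_neg_mul_sub_div {δ : ℝ} (hδ : 0 < δ) (s : ℝ) :
    IntegrableOn (fun x : ℝ => x ^ s * Real.exp (-(δ * x) - δ / x)) (Ioi 0) := by
  obtain ⟨n, hn⟩ := exists_nat_gt (-s)
  refine ((integrableOn_rpow_mul_exp_neg_mul hδ (s := s + n + 1) (by linarith)).const_mul
    (n.factorial / δ ^ n)).mono' (by fun_prop) ?_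
  filter_upwards [ae_restrict_mem measurableSet_Ioi] with x hx
  have hx : 0 < x := hx
  rw [Real.norm_of_nonneg (by positivity), sub_eq_add_neg, Real.exp_add, add_sub_cancel_right,
    Real.rpow_add hx, Real.rpow_natCast]
  have := mul_le_mul_of_nonneg_left (exp_neg_div_le n hδ hx)
    (show 0 ≤ x ^ s * Real.exp (-(δ * x)) by positivity)
  linarith

/-- The Mellin transform of `e^{-rx-b/(rx)}` is holomorphic in `r`. -/
theorem differentiableAt_mellin_expAddDiv {b r₀ : ℂ} (z : ℂ) (h1 : 0 < r₀.re)
    (h2 : 0 < (b / r₀).re) :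
    DifferentiableAt ℂ (fun r => mellin (expAddDiv r (b / r)) z) r₀ := by
  have hr₀ : r₀ ≠ 0 := by rintro rfl; simp at h1
  -- Halving leaves room: both real parts stay above `δ` near `r₀`, which gives one majorant for all
  -- nearby `r`.
  set δ := min (r₀.re / 2) ((b / r₀).re / 2)
  have hδ : 0 < δ := lt_min (by linarith) (by linarith)
  have e1 : ∀ᶠ r in nhds r₀, δ < r.re :=
    Complex.continuous_re.continuousAt.eventually_const_lt
      (lt_of_le_of_lt (min_le_left _ _) (by linarith))
  have e2 : ∀ᶠ r in nhds r₀, δ < (b / r).re := by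
    have hc : ContinuousAt (fun r : ℂ => (b / r).re) r₀ :=
      Complex.continuous_re.continuousAt.comp (continuousAt_const.div continuousAt_id hr₀)
    exact hc.eventually_const_lt (lt_of_le_of_lt (min_le_right _ _) (by linarith))
  set s : Set ℂ := {r | δ < r.re ∧ δ < (b / r).re} with hs
  have hsn : s ∈ nhds r₀ := e1.and e2
  set B := ‖b‖ / δ ^ 2
  have key := hasDerivAt_integral_of_dominated_loc_of_deriv_le (𝕜 := ℂ) (μ := volume.restrict (Ioi 0))
    (F := fun r (x : ℝ) => (x : ℂ) ^ (z - 1) * expAddDiv r (b / r) x)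
    (F' := fun r (x : ℝ) => (x : ℂ) ^ (z - 1) * (expAddDiv r (b / r) x * (-x + b / r ^ 2 / x)))
    -- The `r`-derivative brings down `-x + b/(r²x)`, shifting the power by `+1` and by `-1`; `B`
    -- bounds `|b/r²|` because `|r| ≥ δ`.
    (bound := fun x => x ^ (z.re - 1 + 1) * Real.exp (-(δ * x) - δ / x) +
      B * (x ^ (z.re - 1 - 1) * Real.exp (-(δ * x) - δ / x)))
    (x₀ := r₀) (s := s) hsn ?_ ?_ ?_ ?_ ?_ ?_
  · exact key.2.differentiableAt
  · exact Filter.Eventually.of_forall fun r => aestronglyMeasurable_cpow_mul_expAddDiv _ _ _ _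
  · have hb := integrableOn_rpow_mul_exp_neg_mul_sub_div hδ (z.re - 1)
    refine hb.mono' (aestronglyMeasurable_cpow_mul_expAddDiv _ _ _ _) ?_
    filter_upwards [ae_restrict_mem measurableSet_Ioi] with x hx
    have hx : 0 < x := hx
    rw [norm_mul, Complex.norm_cpow_eq_rpow_re_of_pos hx, norm_expAddDiv, Complex.sub_re,
      Complex.one_re]
    obtain ⟨h3, h4⟩ := mem_of_mem_nhds hsn
    gcongr
  · exact ((Complex.measurable_ofReal.pow_const _).mul ((measurable_expAddDiv _ _).mul
      (by fun_prop))).aestronglyMeasurable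
  · filter_upwards [ae_restrict_mem measurableSet_Ioi] with x hx r hr
    have hx : 0 < x := hx
    obtain ⟨h3, h4⟩ := hr
    have hrn : δ ≤ ‖r‖ := h3.le.trans (Complex.re_le_norm r)
    have h5 : ‖(-(x : ℂ) + b / r ^ 2 / x)‖ ≤ x + B * x⁻¹ := by
      refine (norm_add_le _ _).trans ?_
      rw [norm_neg, norm_div, norm_div, norm_pow, Complex.norm_of_nonneg hx.le, ← div_eq_mul_inv]
      simp only [B]
      gcongr
    have h6 : ‖expAddDiv r (b / r) x‖ ≤ Real.exp (-(δ * x) - δ / x) := by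
      rw [norm_expAddDiv]; gcongr
    rw [norm_mul, norm_mul, Complex.norm_cpow_eq_rpow_re_of_pos hx, Complex.sub_re,
      Complex.one_re, Real.rpow_add hx, Real.rpow_sub_one hx.ne' (z.re - 1), Real.rpow_one]
    calc x ^ (z.re - 1) * (‖expAddDiv r (b / r) x‖ * ‖(-(x : ℂ) + b / r ^ 2 / x)‖)
        ≤ x ^ (z.re - 1) * (Real.exp (-(δ * x) - δ / x) * (x + B * x⁻¹)) := by gcongr
      _ = _ := by ring
  · exact (integrableOn_rpow_mul_exp_neg_mul_sub_div hδ _).add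
      ((integrableOn_rpow_mul_exp_neg_mul_sub_div hδ _).const_mul _)
  · filter_upwards with x r hr
    have hr0 : r ≠ 0 := by rintro rfl; have := hr.1; simp at this; linarith
    refine HasDerivAt.const_mul _ ?_
    unfold expAddDiv
    refine HasDerivAt.cexp ?_
    have h7 : HasDerivAt (fun r : ℂ => b / r) (-(b / r ^ 2)) r := by
      simpa [div_eq_mul_inv] using (hasDerivAt_inv hr0).const_mul b
    have h8 := ((hasDerivAt_id r).neg.mul_const (x : ℂ)).sub (h7.div_const (x : ℂ))
    exact h8.congr_deriv (by ring)

theorem mellin_expAddDiv_scale (b z : ℂ) {r : ℝ} (hr : 0 < r) :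
    mellin (expAddDiv r (b / r)) z = (r : ℂ) ^ (-z) * extGamma b z := by
  rw [extGamma_eq_mellin, ← smul_eq_mul, ← mellin_comp_mul_left _ _ hr]
  congr 1
  ext x
  simp only [expAddDiv, Complex.ofReal_mul, div_div, neg_mul, one_mul]

/-- Both sides are holomorphic in `r` on a connected open set containing `1` and agree at positive
real `r`, so the identity theorem applies. -/
theorem mellin_expAddDiv_of_pos {b r z : ℂ} (hb : 0 < b.re) (hr : 0 < r.re)
    (h : 0 < (b / r).re) : mellin (expAddDiv r (b / r)) z = r ^ (-z) * extGamma b z := by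
  -- For `w ≠ 0`, `b/w` is a positive multiple of `b w̄`, and `Re(b w̄)` is real-linear in `w`.
  -- Hence `U` is an intersection of half-planes, so it is convex.
  set U : Set ℂ := {w | 0 < w.re ∧ 0 < (b * (starRingEnd ℂ) w).re} with hU
  have hdiv : ∀ w : ℂ, 0 < w.re → (0 < (b / w).re ↔ 0 < (b * (starRingEnd ℂ) w).re) := by
    intro w hw
    have hn : 0 < Complex.normSq w := Complex.normSq_pos.2 (by rintro rfl; simp at hw)
    rw [div_eq_mul_inv, Complex.inv_def, ← mul_assoc, Complex.re_mul_ofReal]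
    exact ⟨fun h => by simpa using pos_of_mul_pos_left h (by positivity), fun h => by positivity⟩
  have hUo : IsOpen U := (isOpen_lt continuous_const Complex.continuous_re).inter
    (isOpen_lt continuous_const
      (show Continuous fun w : ℂ => (b * (starRingEnd ℂ) w).re by fun_prop))
  have hUc : Convex ℝ U := by
    intro x hx y hy α β hα hβ hαβ
    simp only [hU, mem_ofPred_eq, Complex.add_re, Complex.mul_re, Complex.conj_re, Complex.conj_im,
      Complex.add_im, Complex.smul_re, Complex.smul_im, smul_eq_mul] at hx hy ⊢
    have hp : ∀ {X Y : ℝ}, 0 < X → 0 < Y → 0 < α * X + β * Y := by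
      intro X Y hX hY
      rcases hα.eq_or_lt with rfl | hα
      · have : β = 1 := by linarith
        subst this; simpa using hY
      · positivity
    refine ⟨hp hx.1 hy.1, ?_⟩
    have := hp hx.2 hy.2
    nlinarith
  have hf : AnalyticOnNhd ℂ (fun r => mellin (expAddDiv r (b / r)) z) U :=
    DifferentiableOn.analyticOnNhd (fun w hw => (differentiableAt_mellin_expAddDiv z hw.1
      ((hdiv w hw.1).2 hw.2)).differentiableWithinAt) hUo
  have hg : AnalyticOnNhd ℂ (fun r : ℂ => r ^ (-z) * extGamma b z) U := by
    refine DifferentiableOn.analyticOnNhd (fun w hw => ?_) hUo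
    exact ((differentiableAt_id.cpow_const (Or.inl hw.1)).mul_const _).differentiableWithinAt
  have h1 : (1 : ℂ) ∈ U := by simp [hU, hb]
  refine hf.eqOn_of_preconnected_of_frequently_eq hg hUc.isPreconnected h1 ?_
    (show r ∈ U from ⟨hr, (hdiv r hr).1 h⟩)
  -- Real points different from `1` accumulate at `1`, which is all that the identity theorem
  -- requires.
  have ht : Filter.Tendsto (fun x : ℝ => (x : ℂ)) (nhdsWithin 1 {1}ᶜ) (nhdsWithin 1 {1}ᶜ) := by
    refine tendsto_nhdsWithin_iff.2 ⟨?_, ?_⟩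
    · exact (Complex.continuous_ofReal.tendsto' _ _ (by simp)).mono_left nhdsWithin_le_nhds
    · filter_upwards [self_mem_nhdsWithin] with x hx
      simpa using hx
  refine ht.frequently (Filter.Eventually.frequently ?_)
  filter_upwards [nhdsWithin_le_nhds (lt_mem_nhds (zero_lt_one' ℝ))] with x hx
  exact mellin_expAddDiv_scale b z hx

/-- Dominated convergence: `Re(q + εw) ≥ 0` makes the majorant independent of `ε`. This gives access
to the boundary case `Re q = 0`. -/
theorem tendsto_mellin_expAddDiv {p z : ℂ} (hp : 0 < p.re) (hz : 0 < z.re) {w q : ℂ}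
    (hq : 0 ≤ q.re) (hw : 0 ≤ w.re) :
    Filter.Tendsto (fun ε : ℝ => mellin (expAddDiv p (q + ε * w)) z) (nhdsWithin 0 (Ioi 0))
      (nhds (mellin (expAddDiv p q) z)) := by
  refine tendsto_integral_filter_of_dominated_convergence
    (fun x => x ^ (z.re - 1) * Real.exp (-(p.re * x)))
    (Filter.Eventually.of_forall fun ε => aestronglyMeasurable_cpow_mul_expAddDiv _ _ _ _) ?_
    (integrableOn_rpow_mul_exp_neg_mul hp hz) ?_
  · filter_upwards [self_mem_nhdsWithin] with ε hε
    have hε : 0 < ε := hε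
    filter_upwards [ae_restrict_mem measurableSet_Ioi] with x hx
    refine norm_cpow_mul_expAddDiv_le ?_ hx
    rw [Complex.add_re, Complex.re_ofReal_mul]
    positivity
  · filter_upwards with x
    have : Continuous fun ε : ℝ => (x : ℂ) ^ (z - 1) • expAddDiv p (q + ε * w) x := by
      unfold expAddDiv; fun_prop
    exact (this.tendsto' 0 _ (by simp)).mono_left nhdsWithin_le_nhds

/-- Rotation of the contour in the extended gamma integral. -/
theorem mellin_expAddDiv {s v z : ℂ} (hs : 0 < s.re) (hv : 0 ≤ v.re) (hsv : 0 ≤ (s * v).re)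
    (hz : 0 < z.re) : mellin (expAddDiv s v) z = s ^ (-z) * extGamma (s * v) z := by
  have hs0 : s ≠ 0 := by rintro rfl; simp at hs
  -- Replacing `v` by `v + ε` turns `sv` into `sv + εs`; both real parts become strictly positive,
  -- so the open case applies before `ε → 0`.
  have h1 := tendsto_mellin_expAddDiv (w := 1) hs hz hv (by simp)
  have h2 := (tendsto_mellin_expAddDiv (p := 1) (w := s) (by simp) hz hsv hs.le).const_mul
    (s ^ (-z))
  rw [← extGamma_eq_mellin] at h2
  refine tendsto_nhds_unique h1 (h2.congr' ?_)
  filter_upwards [self_mem_nhdsWithin] with ε hε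
  have hε : 0 < ε := hε
  have e : v + ε * 1 = (s * v + ε * s) / s := by field_simp
  rw [e, mellin_expAddDiv_of_pos, extGamma_eq_mellin]
  · rw [Complex.add_re, Complex.re_ofReal_mul]; positivity
  · exact hs
  · rw [← e, mul_one, Complex.add_re, Complex.ofReal_re]; positivity

/-! ### The beta integral through a double gamma integral. -/

theorem gamma_mul_one_add_cpow {ρ : ℂ} (hρ : 0 < ρ.re) {x : ℝ} (hx : 0 < x) :
    Complex.Gamma ρ * ((1 + x : ℝ) : ℂ) ^ (-ρ) =
      ∫ t in Ioi (0 : ℝ), (t : ℂ) ^ (ρ - 1) * Complex.exp (-((1 + x : ℝ) * t)) := by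
  have h := Complex.integral_cpow_mul_exp_neg_mul_Ioi hρ
    (r := 1 + x) (by positivity)
  have harg : (((1 + x : ℝ) : ℂ)).arg ≠ Real.pi := by
    rw [Complex.arg_ofReal_of_nonneg (by positivity)]; exact Real.pi_pos.ne
  rw [h, one_div, Complex.inv_cpow _ _ harg, Complex.cpow_neg, mul_comm]

theorem integrable_beta_kernel {ρ s : ℂ} (hs : 0 < s.re) (hρs : 0 < (ρ - s).re) :
    Integrable (Function.uncurry fun x t : ℝ => (x : ℂ) ^ (s - 1) *
      ((t : ℂ) ^ (ρ - 1) * Complex.exp (-((1 + x : ℝ) * t))))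
      ((volume.restrict (Ioi 0)).prod (volume.restrict (Ioi 0))) := by
  have hm : Measurable (Function.uncurry fun x t : ℝ => (x : ℂ) ^ (s - 1) *
      ((t : ℂ) ^ (ρ - 1) * Complex.exp (-((1 + x : ℝ) * t)))) := by
    refine ((Complex.measurable_ofReal.comp measurable_fst).pow_const _).mul
      (((Complex.measurable_ofReal.comp measurable_snd).pow_const _).mul ?_)
    fun_prop
  have hn : ∀ x ∈ Ioi (0 : ℝ), ∀ t ∈ Ioi (0 : ℝ), ‖(x : ℂ) ^ (s - 1) *
      ((t : ℂ) ^ (ρ - 1) * Complex.exp (-((1 + x : ℝ) * t)))‖ =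
      t ^ (ρ.re - 1) * Real.exp (-t) * (x ^ (s.re - 1) * Real.exp (-(t * x))) := by
    intro x hx t ht
    rw [norm_mul, norm_mul, Complex.norm_cpow_eq_rpow_re_of_pos hx,
      Complex.norm_cpow_eq_rpow_re_of_pos ht, Complex.norm_exp, ← Complex.ofReal_mul,
      ← Complex.ofReal_neg, Complex.ofReal_re, add_mul, neg_add, Real.exp_add]
    simp only [Complex.sub_re, Complex.one_re, one_mul, mul_comm x t]
    ring
  rw [integrable_prod_iff' hm.aestronglyMeasurable]
  constructor
  · filter_upwards [ae_restrict_mem measurableSet_Ioi] with t ht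
    refine Integrable.mono' ((integrableOn_rpow_mul_exp_neg_mul ht hs).const_mul
      (t ^ (ρ.re - 1) * Real.exp (-t))) (hm.comp measurable_prodMk_right).aestronglyMeasurable ?_
    filter_upwards [ae_restrict_mem measurableSet_Ioi] with x hx
    exact (hn x hx t ht).le
  -- Integrating the norm over `x` gives `Γ(Re s) t^{-Re s}`, which leaves a gamma integrand with
  -- exponent `Re(ρ-s)`.
  · have hi := (integrableOn_rpow_mul_exp_neg_mul one_pos hρs).mul_const (Real.Gamma s.re)
    refine hi.congr ?_
    filter_upwards [ae_restrict_mem measurableSet_Ioi] with t ht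
    have ht : 0 < t := ht
    calc t ^ ((ρ - s).re - 1) * Real.exp (-(1 * t)) * Real.Gamma s.re
        = t ^ (ρ.re - 1) * Real.exp (-t) *
          ∫ x in Ioi (0 : ℝ), x ^ (s.re - 1) * Real.exp (-(t * x)) := by
          rw [Real.integral_rpow_mul_exp_neg_mul_Ioi hs ht, one_div, Real.inv_rpow ht.le,
            ← Real.rpow_neg ht.le, Complex.sub_re, show ρ.re - s.re - 1 = ρ.re - 1 + -s.re by ring,
            Real.rpow_add ht, one_mul]
          ring
      _ = _ := by
          rw [← integral_const_mul]
          exact setIntegral_congr_fun measurableSet_Ioi fun x hx => (hn x hx t ht).symm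

/-- The beta integral on the half-line, as a Mellin transform. -/
theorem gamma_mul_mellin_one_add_cpow {ρ s : ℂ} (hs : 0 < s.re) (hρs : 0 < (ρ - s).re) :
    Complex.Gamma ρ * mellin (fun x => ((1 + x : ℝ) : ℂ) ^ (-ρ)) s =
      Complex.Gamma s * Complex.Gamma (ρ - s) := by
  have hρ : 0 < ρ.re := by rw [Complex.sub_re] at hρs; linarith
  calc Complex.Gamma ρ * mellin (fun x => ((1 + x : ℝ) : ℂ) ^ (-ρ)) s
      = ∫ x in Ioi (0 : ℝ), ∫ t in Ioi (0 : ℝ), (x : ℂ) ^ (s - 1) *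
          ((t : ℂ) ^ (ρ - 1) * Complex.exp (-((1 + x : ℝ) * t))) := by
        rw [mellin, ← integral_const_mul]
        refine setIntegral_congr_fun measurableSet_Ioi fun x hx => ?_
        simp only [smul_eq_mul]
        rw [integral_const_mul, ← gamma_mul_one_add_cpow hρ hx]
        ring
    _ = ∫ t in Ioi (0 : ℝ), ∫ x in Ioi (0 : ℝ), (x : ℂ) ^ (s - 1) *
          ((t : ℂ) ^ (ρ - 1) * Complex.exp (-((1 + x : ℝ) * t))) :=
        integral_integral_swap (integrable_beta_kernel hs hρs)
    _ = ∫ t in Ioi (0 : ℝ), Complex.Gamma s *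
          (Complex.exp (-t) * (t : ℂ) ^ (ρ - s - 1)) := by
        refine setIntegral_congr_fun measurableSet_Ioi fun t ht => ?_
        have ht : 0 < t := ht
        have htc : (t : ℂ) ≠ 0 := by exact_mod_cast ht.ne'
        have e : ∀ x : ℝ, (x : ℂ) ^ (s - 1) *
          ((t : ℂ) ^ (ρ - 1) * Complex.exp (-((1 + x : ℝ) * t))) =
          (t : ℂ) ^ (ρ - 1) * Complex.exp (-t) *
            ((x : ℂ) ^ (s - 1) * Complex.exp (-(t * x))) := by
          intro x
          rw [show -(((1 + x : ℝ) : ℂ) * t) = -t + -(t * x) by push_cast; ring, Complex.exp_add]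
          ring
        simp only [e]
        have harg : ((t : ℂ)).arg ≠ Real.pi := by
          rw [Complex.arg_ofReal_of_nonneg ht.le]; exact Real.pi_pos.ne
        rw [integral_const_mul, Complex.integral_cpow_mul_exp_neg_mul_Ioi hs ht,
          one_div, Complex.inv_cpow _ _ harg, ← Complex.cpow_neg,
          show ρ - s - 1 = ρ - 1 + -s by ring, Complex.cpow_add _ _ htc]
        ring
    _ = _ := by
        rw [integral_const_mul, Complex.Gamma_eq_integral hρs, Complex.GammaIntegral]
        simp

/-! ### Gamma products on vertical lines and Mellin inversion. -/

theorem norm_gamma_le {z : ℂ} (hz : 0 < z.re) : ‖Complex.Gamma z‖ ≤ Real.Gamma z.re := by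
  rw [Complex.Gamma_eq_integral hz, Real.Gamma_eq_integral hz]
  refine norm_integral_le_of_norm_le (Real.GammaIntegral_convergent hz) ?_
  filter_upwards [ae_restrict_mem measurableSet_Ioi] with x hx
  rw [norm_mul, Complex.norm_cpow_eq_rpow_re_of_pos hx, Complex.norm_real, Real.norm_of_nonneg (Real.exp_pos _).le]
  simp

theorem continuous_gamma_comp {f : ℝ → ℂ} (hf : Continuous f) (h : ∀ y, 0 < (f y).re) :
    Continuous fun y => Complex.Gamma (f y) := by
  refine continuous_iff_continuousAt.2 fun y => ?_
  refine ContinuousAt.comp (g := Complex.Gamma) ?_ hf.continuousAt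
  refine (Complex.differentiableAt_Gamma _ fun n hn => ?_).continuousAt
  have := h y
  rw [hn] at this
  simp at this
  linarith [(Nat.cast_nonneg n : (0 : ℝ) ≤ n)]

/-- The product of gamma functions in the beta integral is integrable on vertical lines. -/
theorem verticalIntegrable_gamma_mul_gamma {ρ : ℂ} {σ : ℝ} (hσ : 0 < σ) (hρσ : σ < ρ.re) :
    Complex.VerticalIntegrable (fun s => Complex.Gamma s * Complex.Gamma (ρ - s)) σ := by
  set d := ρ.re - σ
  have hd : 0 < d := by simp only [d]; linarith
  have hre : ∀ y : ℝ, ((σ : ℂ) + y * Complex.I).re = σ := by simp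
  have hre2 : ∀ y : ℝ, (ρ - ((σ : ℂ) + y * Complex.I)).re = d := by simp [d]
  -- Writing `Γ(A) = Γ(A+1)/A` for each factor gives decay `1/(|A||B|)`, and `2pq ≤ p² + q²` splits
  -- it into two integrable terms; the `1/2` comes from there.
  set C := Real.Gamma (σ + 1) * Real.Gamma (d + 1) / 2
  have hC : 0 ≤ C := by
    have := Real.Gamma_pos_of_pos (show 0 < σ + 1 by linarith)
    have := Real.Gamma_pos_of_pos (show 0 < d + 1 by linarith)
    positivity
  have hint : ∀ {e : ℝ}, 0 < e → Integrable fun y : ℝ => 1 / (e ^ 2 + y ^ 2) := by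
    intro e he
    refine ((integrable_inv_one_add_sq.comp_div he.ne').const_mul (1 / e ^ 2)).congr ?_
    filter_upwards with y
    field_simp
  have hbound : ∀ y : ℝ, ‖Complex.Gamma (σ + y * Complex.I) *
      Complex.Gamma (ρ - (σ + y * Complex.I))‖ ≤
      C * (1 / (σ ^ 2 + y ^ 2) + 1 / (d ^ 2 + (y - ρ.im) ^ 2)) := by
    intro y
    set A : ℂ := σ + y * Complex.I with hA
    set B : ℂ := ρ - A with hB
    have hAr : A.re = σ := hre y
    have hBr : B.re = d := hre2 y
    have hA0 : A ≠ 0 := fun h => by rw [h] at hAr; simp at hAr; linarith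
    have hB0 : B ≠ 0 := fun h => by rw [h] at hBr; simp at hBr; linarith
    have hAn : ‖A‖ ^ 2 = σ ^ 2 + y ^ 2 := by
      rw [Complex.sq_norm, Complex.normSq_apply, hAr]; simp [hA]; ring
    have hBn : ‖B‖ ^ 2 = d ^ 2 + (y - ρ.im) ^ 2 := by
      rw [Complex.sq_norm, Complex.normSq_apply, hBr]; simp [hB, hA]; ring
    have hAp : 0 < ‖A‖ := norm_pos_iff.2 hA0
    have hBp : 0 < ‖B‖ := norm_pos_iff.2 hB0
    have h1 : ‖Complex.Gamma A‖ ≤ Real.Gamma (σ + 1) / ‖A‖ := by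
      rw [le_div_iff₀ hAp, mul_comm, ← norm_mul, ← Complex.Gamma_add_one A hA0]
      have := norm_gamma_le (z := A + 1) (by simp [hAr]; linarith)
      simpa [hAr] using this
    have h2 : ‖Complex.Gamma B‖ ≤ Real.Gamma (d + 1) / ‖B‖ := by
      rw [le_div_iff₀ hBp, mul_comm, ← norm_mul, ← Complex.Gamma_add_one B hB0]
      have := norm_gamma_le (z := B + 1) (by simp [hBr]; linarith)
      simpa [hBr] using this
    rw [norm_mul, ← hAn, ← hBn]
    calc ‖Complex.Gamma A‖ * ‖Complex.Gamma B‖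
        ≤ (Real.Gamma (σ + 1) / ‖A‖) * (Real.Gamma (d + 1) / ‖B‖) :=
          mul_le_mul h1 h2 (norm_nonneg _) ((norm_nonneg _).trans h1)
      _ = C * (2 * (1 / ‖A‖) * (1 / ‖B‖)) := by simp only [C]; field_simp
      _ ≤ C * (1 / ‖A‖ ^ 2 + 1 / ‖B‖ ^ 2) := by
          refine mul_le_mul_of_nonneg_left ?_ hC
          simpa using two_mul_le_add_sq (1 / ‖A‖) (1 / ‖B‖)
  refine (((hint hσ).add ((hint hd).comp_sub_right ρ.im)).const_mul C).mono' ?_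
    (Filter.Eventually.of_forall hbound)
  refine Continuous.aestronglyMeasurable ?_
  exact (continuous_gamma_comp (by fun_prop) fun y => by rw [hre]; exact hσ).mul
    (continuous_gamma_comp (by fun_prop) fun y => by rw [hre2]; exact hd)

/-- The Mellin–Barnes integral of `(1+x)^{-ρ}`. -/
theorem integral_gamma_mul_gamma_mul_cpow {ρ : ℂ} {σ : ℝ} (hσ : 0 < σ) (hρσ : σ < ρ.re) {x : ℝ}
    (hx : 0 < x) :
    ∫ y : ℝ, Complex.Gamma (σ + y * Complex.I) * Complex.Gamma (ρ - (σ + y * Complex.I)) *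
      (x : ℂ) ^ (-((σ : ℂ) + y * Complex.I)) =
    2 * Real.pi * Complex.Gamma ρ * ((1 + x : ℝ) : ℂ) ^ (-ρ) := by
  have hρ : 0 < ρ.re := hσ.trans hρσ
  have hΓ : Complex.Gamma ρ ≠ 0 := Complex.Gamma_ne_zero_of_re_pos hρ
  set f : ℝ → ℂ := fun x => ((1 + x : ℝ) : ℂ) ^ (-ρ) with hf
  have hmel : ∀ y : ℝ, mellin f (σ + y * Complex.I) = (Complex.Gamma ρ)⁻¹ *
      (Complex.Gamma (σ + y * Complex.I) * Complex.Gamma (ρ - (σ + y * Complex.I))) := by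
    intro y
    rw [← gamma_mul_mellin_one_add_cpow (by simpa using hσ) (by simpa using hρσ),
      inv_mul_cancel_left₀ hΓ]
  have hconv : MellinConvergent f σ := by
    have := (integrable_beta_kernel (ρ := ρ) (s := σ) (by simpa using hσ)
      (by simpa using hρσ)).integral_prod_left
    refine (this.const_mul (Complex.Gamma ρ)⁻¹).congr ?_
    filter_upwards [ae_restrict_mem measurableSet_Ioi] with x hx
    simp only [Function.uncurry, smul_eq_mul]
    rw [integral_const_mul, ← gamma_mul_one_add_cpow hρ hx, hf]
    field_simp
  have hvert : Complex.VerticalIntegrable (mellin f) σ := by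
    refine ((verticalIntegrable_gamma_mul_gamma hσ hρσ).const_mul (Complex.Gamma ρ)⁻¹).congr ?_
    filter_upwards with y
    exact (hmel y).symm
  have hcont : ContinuousAt f x := by
    refine ContinuousAt.cpow (by fun_prop) continuousAt_const ?_
    rw [Complex.ofReal_mem_slitPlane]
    positivity
  have key := mellinInv_mellin_eq σ f hx hconv hvert hcont
  rw [mellinInv] at key
  simp only [hmel, smul_eq_mul] at key
  rw [show ((1 + x : ℝ) : ℂ) ^ (-ρ) = f x from rfl, ← key, Complex.real_smul,
    ← integral_const_mul, ← integral_const_mul]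
  congr 1
  ext y
  have : (Real.pi : ℂ) ≠ 0 := by exact_mod_cast Real.pi_ne_zero
  push_cast
  field_simp

/-- The substitution `σ = -t/m` with `x^m` in place of `x`; its Jacobian is the factor `m`. The form
`1 - 1 - t/m` matches `Γ(1-a-αt)` at `a = 1`. -/
theorem integral_gamma_mul_gamma_mul_cpow_scaled {ρ : ℂ} {m : ℕ} (hm : 0 < m) {c : ℝ} (hc : c < 0)
    (hρc : 0 < ρ.re + 1 / m * c) {x : ℝ} (hx : 0 < x) :
    ∫ y : ℝ, Complex.Gamma (1 - 1 - ((1 / m : ℝ) : ℂ) * (c + y * Complex.I)) *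
      Complex.Gamma (ρ + ((1 / m : ℝ) : ℂ) * (c + y * Complex.I)) *
      (x : ℂ) ^ ((c : ℂ) + y * Complex.I) =
    2 * Real.pi * m * Complex.Gamma ρ * ((1 + x ^ m : ℝ) : ℂ) ^ (-ρ) := by
  have hm' : (0 : ℝ) < m := by exact_mod_cast hm
  have hmc : (m : ℂ) ≠ 0 := by exact_mod_cast hm.ne'
  have hσ : 0 < -(1 / m * c) := by
    have : 0 < 1 / (m : ℝ) := by positivity
    nlinarith
  have h := integral_gamma_mul_gamma_mul_cpow (ρ := ρ) hσ (by linarith) (pow_pos hx m)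
  rw [show (2 : ℂ) * Real.pi * m * Complex.Gamma ρ * ((1 + x ^ m : ℝ) : ℂ) ^ (-ρ) =
    m * (2 * Real.pi * Complex.Gamma ρ * ((1 + x ^ m : ℝ) : ℂ) ^ (-ρ)) by ring, ← h]
  have hs := Measure.integral_comp_mul_left (fun y : ℝ =>
    Complex.Gamma ((-(1 / m * c) : ℝ) + y * Complex.I) *
      Complex.Gamma (ρ - ((-(1 / m * c) : ℝ) + y * Complex.I)) *
      ((x ^ m : ℝ) : ℂ) ^ (-(((-(1 / m * c) : ℝ) : ℂ) + y * Complex.I))) (-(1 / (m : ℝ)))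
  have habs : |(-(1 / (m : ℝ)))⁻¹| = m := by
    rw [abs_inv, abs_neg, abs_of_pos (by positivity)]; simp
  rw [habs, Complex.real_smul] at hs
  rw [← Complex.ofReal_natCast, ← hs]
  congr 1
  ext y
  -- The logarithm is real, so `(x^m)^w = x^{mw}` holds without leaving the principal branch.
  have hlog : (Complex.log (x : ℂ) * m).im = 0 := by
    rw [← Complex.ofReal_log hx.le]; simp
  rw [Complex.ofReal_pow, ← Complex.cpow_natCast (x : ℂ) m, ← Complex.cpow_mul]
  · congr 2
    · congr 1; push_cast; field_simp; ring
    · congr 1; push_cast; field_simp; ring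
    · push_cast; field_simp; ring
  · rw [hlog]; linarith [Real.pi_pos]
  · rw [hlog]; exact Real.pi_pos.le

theorem integrable_gamma_mul_gamma_scaled {ρ : ℂ} {m : ℕ} (hm : 0 < m) {c : ℝ} (hc : c < 0)
    (hρc : 0 < ρ.re + 1 / m * c) :
    Integrable fun y : ℝ => Complex.Gamma (1 - 1 - ((1 / m : ℝ) : ℂ) * (c + y * Complex.I)) *
      Complex.Gamma (ρ + ((1 / m : ℝ) : ℂ) * (c + y * Complex.I)) := by
  have hm' : (0 : ℝ) < m := by exact_mod_cast hm
  have hσ : 0 < -(1 / m * c) := by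
    have : 0 < 1 / (m : ℝ) := by positivity
    nlinarith
  have h := Integrable.comp_mul_left' (verticalIntegrable_gamma_mul_gamma (ρ := ρ) hσ (by linarith))
    (R := -(1 / (m : ℝ))) (by simpa using hm.ne')
  refine h.congr (Filter.Eventually.of_forall fun y => ?_)
  simp only
  congr 2 <;> · push_cast; ring

/-! ### Interchange of the `x`-integral and the Mellin–Barnes integral. -/

/-- The rotation formula at `z = λ + t`, read backwards, opens `Γ_{sv}` into an `x`-integral; `s^λ`
is the part of `s^{-z}` not absorbed by `(sω)^{-t}`. -/
theorem extHIntegrand_eq {ρ s v : ℂ} {m : ℕ} {lam ω c : ℝ} (hω : 0 < ω) (hs : 0 < s.re)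
    (hv : 0 ≤ v.re) (hsv : 0 ≤ (s * v).re) {t : ℂ} (ht : t.re = c) (hlc : 0 < lam + c) :
    extHIntegrand 1 (1 / m) lam 1 ρ (1 / m) (s * v) (s * ω) t = s ^ (lam : ℂ) *
      ∫ x in Ioi (0 : ℝ), (x : ℂ) ^ (lam + t - 1) * expAddDiv s v x *
        (Complex.Gamma (1 - 1 - ((1 / m : ℝ) : ℂ) * t) *
          Complex.Gamma (ρ + ((1 / m : ℝ) : ℂ) * t) * (ω : ℂ) ^ (-t)) := by
  have hs0 : s ≠ 0 := by rintro rfl; simp at hs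
  have h := mellin_expAddDiv (z := lam + t) hs hv hsv (by simpa [ht] using hlc)
  rw [mellin] at h
  simp only [smul_eq_mul] at h
  have hpow : (s * ω) ^ (-t) = s ^ (-t) * (ω : ℂ) ^ (-t) := by
    have hωc : (ω : ℂ) ≠ 0 := by exact_mod_cast hω.ne'
    rw [mul_comm s, Complex.cpow_def_of_ne_zero (mul_ne_zero hωc hs0), Complex.log_ofReal_mul hω hs0,
      Complex.ofReal_log hω.le, add_mul, Complex.exp_add, Complex.cpow_def_of_ne_zero hs0,
      Complex.cpow_def_of_ne_zero hωc, mul_comm]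
  have hsp : s ^ (lam : ℂ) * s ^ (-(lam + t)) = s ^ (-t) := by
    rw [← Complex.cpow_add _ _ hs0]; congr 1; ring
  rw [integral_mul_const, h, extHIntegrand, hpow, ← hsp]
  push_cast
  ring_nf

/-- On a vertical line `|x^{λ+t-1}|` and `|ω^{-t}|` do not depend on `Im t`, so the kernel is
dominated by a product of a function of `x` and a function of `y`. -/
theorem integrable_mellinBarnes_kernel {h : ℝ → ℂ} (hh : Integrable h) {s v : ℂ} (hs : 0 < s.re)
    (hv : 0 ≤ v.re) {lam ω c : ℝ} (hω : 0 < ω) (hlc : 0 < lam + c) :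
    Integrable (Function.uncurry fun x y : ℝ =>
      (x : ℂ) ^ ((lam : ℂ) + (c + y * Complex.I) - 1) * expAddDiv s v x *
        (h y * (ω : ℂ) ^ (-((c : ℂ) + y * Complex.I)))) ((volume.restrict (Ioi 0)).prod volume) := by
  refine ((integrableOn_rpow_mul_exp_neg_mul hs hlc).mul_prod
    (hh.norm.mul_const (ω ^ (-c)))).mono' ?_ ?_
  · refine AEStronglyMeasurable.mul (Measurable.aestronglyMeasurable ?_)
      (AEStronglyMeasurable.mul hh.aestronglyMeasurable.comp_snd
        (Measurable.aestronglyMeasurable ?_))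
    · exact ((Complex.measurable_ofReal.comp measurable_fst).pow (by fun_prop)).mul
        ((measurable_expAddDiv s v).comp measurable_fst)
    · exact measurable_const.pow (by fun_prop)
  · have : ∀ᵐ p : ℝ × ℝ ∂((volume.restrict (Ioi 0)).prod volume), p.1 ∈ Ioi (0 : ℝ) :=
      Measure.quasiMeasurePreserving_fst.ae (ae_restrict_mem measurableSet_Ioi)
    filter_upwards [this] with p hp
    have hp : 0 < p.1 := hp
    simp only [Function.uncurry]
    have h1 := norm_cpow_mul_expAddDiv_le (p := s) (q := v)
      (z := (lam : ℂ) + (c + p.2 * Complex.I)) hv hp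
    simp only [Complex.add_re, Complex.ofReal_re, Complex.re_ofReal_mul, Complex.I_re, mul_zero,
      add_zero] at h1
    rw [norm_mul, norm_mul (h p.2), Complex.norm_cpow_eq_rpow_re_of_pos hω]
    simp only [Complex.neg_re, Complex.add_re, Complex.ofReal_re, Complex.re_ofReal_mul,
      Complex.I_re, mul_zero, add_zero]
    gcongr

/-- The absolutely convergent Mellin–Barnes representation of the transform of `x^{λ-1}`. -/
theorem verticalIntegrable_and_integral_eq {ρ s v : ℂ} (hρ : 0 < ρ.re) {m : ℕ} (hm : 0 < m)
    {lam ω : ℝ} (hω : 0 < ω) (hs : 0 < s.re) (hv : 0 ≤ v.re) (hsv : 0 ≤ (s * v).re) {c : ℝ}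
    (hc : IsExtHAbscissa 1 (1 / m) lam 1 ρ (1 / m) c) :
    Complex.VerticalIntegrable
      (extHIntegrand 1 (1 / m) lam 1 ρ (1 / m) (s * v) (s * ω)) c ∧
    ∫ x in Ioi (0 : ℝ), (x : ℂ) ^ ((lam : ℂ) - 1) * expAddDiv s v x *
        ((x ^ m + ω ^ m : ℝ) : ℂ) ^ (-ρ) =
      (ω : ℂ) ^ (-(m * ρ)) * s ^ (-(lam : ℂ)) / (m * Complex.Gamma ρ) *
        extH c 1 (1 / m) lam 1 ρ (1 / m) (s * v) (s * ω) := by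
  obtain ⟨hc1, hc2, hc3⟩ := hc
  have hm' : (0 : ℝ) < m := by exact_mod_cast hm
  have hmc : (m : ℂ) ≠ 0 := by exact_mod_cast hm.ne'
  have hs0 : s ≠ 0 := by rintro rfl; simp at hs
  have hωc : (ω : ℂ) ≠ 0 := by exact_mod_cast hω.ne'
  have hc0 : c < 0 := by
    simp only [Complex.one_re, sub_self, zero_sub] at hc1
    by_contra hcon
    have : 0 ≤ 1 / (m : ℝ) * c := mul_nonneg (by positivity) (not_lt.1 hcon)
    linarith
  simp only [Complex.ofReal_re, one_mul] at hc2
  have hh := integrable_gamma_mul_gamma_scaled hm hc0 hc3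
  have hK := integrable_mellinBarnes_kernel hh hs hv hω hc2
  have hH : ∀ y : ℝ, extHIntegrand 1 (1 / m) lam 1 ρ (1 / m) (s * v) (s * ω)
      (c + y * Complex.I) = _ := fun y => extHIntegrand_eq hω hs hv hsv (by simp) hc2
  constructor
  -- The `H`-integrand is, up to a constant, a marginal of the jointly integrable kernel.
  · refine (hK.integral_prod_right.const_mul (s ^ (lam : ℂ))).congr ?_
    filter_upwards with y
    exact (hH y).symm
  · have hpi : (Real.pi : ℂ) ≠ 0 := by exact_mod_cast Real.pi_ne_zero
    have hΓ : Complex.Gamma ρ ≠ 0 := Complex.Gamma_ne_zero_of_re_pos hρ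
    have hsw := integral_integral_swap hK
    have hinner : ∀ x ∈ Ioi (0 : ℝ), (x : ℂ) ^ ((lam : ℂ) - 1) * expAddDiv s v x *
        ((x ^ m + ω ^ m : ℝ) : ℂ) ^ (-ρ) = (ω : ℂ) ^ (-(m * ρ)) / (2 * Real.pi * m *
          Complex.Gamma ρ) * ∫ y : ℝ, (x : ℂ) ^ ((lam : ℂ) + (c + y * Complex.I) - 1) *
        expAddDiv s v x * (Complex.Gamma (1 - 1 - ((1 / m : ℝ) : ℂ) * (c + y * Complex.I)) *
          Complex.Gamma (ρ + ((1 / m : ℝ) : ℂ) * (c + y * Complex.I)) *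
          (ω : ℂ) ^ (-((c : ℂ) + y * Complex.I))) := by
      intro x hx
      have hx : 0 < x := hx
      have hxc : (x : ℂ) ≠ 0 := by exact_mod_cast hx.ne'
      have hb := integral_gamma_mul_gamma_mul_cpow_scaled (ρ := ρ) hm hc0 hc3 (div_pos hx hω)
      have e : ∀ y : ℝ, (x : ℂ) ^ ((lam : ℂ) + (c + y * Complex.I) - 1) *
        expAddDiv s v x * (Complex.Gamma (1 - 1 - ((1 / m : ℝ) : ℂ) * (c + y * Complex.I)) *
          Complex.Gamma (ρ + ((1 / m : ℝ) : ℂ) * (c + y * Complex.I)) *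
          (ω : ℂ) ^ (-((c : ℂ) + y * Complex.I))) = (x : ℂ) ^ ((lam : ℂ) - 1) * expAddDiv s v x *
          (Complex.Gamma (1 - 1 - ((1 / m : ℝ) : ℂ) * (c + y * Complex.I)) *
      Complex.Gamma (ρ + ((1 / m : ℝ) : ℂ) * (c + y * Complex.I)) *
      ((x / ω : ℝ) : ℂ) ^ ((c : ℂ) + y * Complex.I)) := by
        intro y
        rw [show (lam : ℂ) + (c + y * Complex.I) - 1 = (lam - 1) + (c + y * Complex.I) by ring,
          Complex.cpow_add _ _ hxc, div_eq_mul_inv x ω, Complex.ofReal_mul,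
          Complex.mul_cpow_ofReal_nonneg hx.le (by positivity), Complex.ofReal_inv,
          Complex.inv_cpow _ _ (by rw [Complex.arg_ofReal_of_nonneg hω.le]; exact Real.pi_pos.ne),
          ← Complex.cpow_neg]
        ring
      simp only [e]
      rw [integral_const_mul, hb]
      have e2 : ((x ^ m + ω ^ m : ℝ) : ℂ) ^ (-ρ) =
          (ω : ℂ) ^ (-(m * ρ)) * ((1 + (x / ω) ^ m : ℝ) : ℂ) ^ (-ρ) := by
        have e3 : x ^ m + ω ^ m = ω ^ m * (1 + (x / ω) ^ m) := by
          rw [div_pow]; field_simp; ring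
        rw [e3, Complex.ofReal_mul, Complex.mul_cpow_ofReal_nonneg (by positivity) (by positivity)]
        congr 1
        have hlog : (Complex.log (ω : ℂ) * m).im = 0 := by
          rw [← Complex.ofReal_log hω.le]; simp
        rw [Complex.ofReal_pow, ← Complex.cpow_natCast (ω : ℂ) m, ← Complex.cpow_mul]
        · congr 1; ring
        · rw [hlog]; linarith [Real.pi_pos]
        · rw [hlog]; exact Real.pi_pos.le
      rw [e2]
      field_simp
    rw [setIntegral_congr_fun measurableSet_Ioi hinner, integral_const_mul, hsw, extH]
    simp only [hH]
    rw [integral_mul_const, integral_const_mul, Complex.cpow_neg s]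
    have hsl : s ^ (lam : ℂ) ≠ 0 := by simp [Complex.cpow_eq_zero_iff, hs0]
    generalize (∫ y : ℝ, ∫ x in Ioi (0 : ℝ), _ : ℂ) = J
    have := Complex.I_ne_zero
    field_simp

/-! ### Admissible abscissas, convergence of the transform, and the three cases. -/

theorem exists_isExtHAbscissa {ρ : ℂ} (hρ : 0 < ρ.re) {m : ℕ} (hm : 0 < m) {lam : ℝ}
    (hlam : 0 < lam) : ∃ c : ℝ, IsExtHAbscissa 1 (1 / m) lam 1 ρ (1 / m) c := by
  have hm' : (1 : ℝ) ≤ m := by exact_mod_cast hm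
  -- The constraints are `-λ < c < 0` and `c > -m Re ρ`; as `m ≥ 1`, half of the smaller of `λ` and
  -- `Re ρ` suffices.
  refine ⟨-(min lam ρ.re / 2), ?_⟩
  have hmin : 0 < min lam ρ.re := lt_min hlam hρ
  have h1 := min_le_left lam ρ.re
  have h2 := min_le_right lam ρ.re
  have hi : 1 / (m : ℝ) ≤ 1 := by rw [div_le_one (by linarith)]; exact hm'
  have hi0 : 0 < 1 / (m : ℝ) := by positivity
  refine ⟨?_, ?_, ?_⟩
  · simp only [Complex.one_re]; nlinarith
  · simp only [Complex.ofReal_re]; linarith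
  · nlinarith

theorem norm_cpow_neg_add_pow_le {ρ : ℂ} (hρ : 0 < ρ.re) (m : ℕ) {ω x : ℝ} (hω : 0 < ω)
    (hx : 0 < x) : ‖((x ^ m + ω ^ m : ℝ) : ℂ) ^ (-ρ)‖ ≤ (ω ^ m) ^ (-ρ.re) := by
  rw [Complex.norm_cpow_eq_rpow_re_of_pos (by positivity), Complex.neg_re]
  exact Real.rpow_le_rpow_of_nonpos (by positivity)
    (le_add_of_nonneg_left (by positivity)) (by linarith)

theorem integrableOn_cpow_mul_expAddDiv_mul_cpow {ρ s v : ℂ} (hρ : 0 < ρ.re) (m : ℕ)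
    {lam ω : ℝ} (hlam : 0 < lam) (hω : 0 < ω) (hs : 0 < s.re) (hv : 0 ≤ v.re) :
    IntegrableOn (fun x : ℝ => (x : ℂ) ^ ((lam : ℂ) - 1) * expAddDiv s v x *
        ((x ^ m + ω ^ m : ℝ) : ℂ) ^ (-ρ)) (Ioi 0) := by
  have h : IntegrableOn (fun x : ℝ => (x : ℂ) ^ ((lam : ℂ) - 1) * expAddDiv s v x) (Ioi 0) :=
    mellinConvergent_expAddDiv (z := lam) hs hv (by simpa using hlam)
  -- The factor `(x^m+ω^m)^{-ρ}` is bounded because `Re ρ > 0` and `ω > 0`, so the gamma-type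
  -- integrand alone gives convergence.
  refine Integrable.mul_bdd (c := (ω ^ m) ^ (-ρ.re)) h ?_ ?_
  · have : Measurable fun x : ℝ => ((x ^ m + ω ^ m : ℝ) : ℂ) := by fun_prop
    exact (this.pow_const _).aestronglyMeasurable
  · filter_upwards [ae_restrict_mem measurableSet_Ioi] with x hx
    exact norm_cpow_neg_add_pow_le hρ m hω hx

theorem mIntegrand_rpow_mul_exp (ρ : ℂ) (m : ℕ) (lam a : ℝ) (u v : ℂ) {ω x : ℝ} (hω : 0 < ω)
    (hx : 0 < x) :
    mIntegrand ρ m (fun x => ((x ^ (lam - 1) * Real.exp (-(a * x)) : ℝ) : ℂ)) u v ω x =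
      (ω : ℂ) ^ ((lam : ℂ) - 1) * ((x : ℂ) ^ ((lam : ℂ) - 1) * expAddDiv (u + a * ω) v x *
        ((x ^ m + ω ^ m : ℝ) : ℂ) ^ (-ρ)) := by
  have e : expAddDiv (u + a * ω) v x =
      Complex.exp (-u * x - v / x) * ((Real.exp (-(a * (ω * x))) : ℝ) : ℂ) := by
    rw [expAddDiv, Complex.ofReal_exp, ← Complex.exp_add]
    congr 1
    push_cast
    ring
  rw [mIntegrand, e, Complex.ofReal_mul, Complex.ofReal_cpow (by positivity), Complex.ofReal_mul,
    Complex.mul_cpow_ofReal_nonneg hω.le hx.le, Complex.cpow_neg, div_eq_mul_inv]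
  push_cast
  ring

/-- The transform of `x^{λ-1} e^{-ax}`, with the common factors of both sides collected. -/
theorem mTransform_rpow_mul_exp {ρ : ℂ} (hρ : 0 < ρ.re) {m : ℕ} (hm : 0 < m) {lam : ℝ}
    (hlam : 0 < lam) (a : ℝ) {u v : ℂ} {ω : ℝ} (hω : 0 < ω) (hv : 0 ≤ v.re)
    (hs : 0 < (u + a * ω).re) (hsv : 0 ≤ ((u + a * ω) * v).re) :
    IntegrableOn
      (mIntegrand ρ m (fun x => ((x ^ (lam - 1) * Real.exp (-(a * x)) : ℝ) : ℂ)) u v ω) (Ioi 0) ∧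
    (∃ c : ℝ, IsExtHAbscissa 1 (1 / m) lam 1 ρ (1 / m) c) ∧
    ∀ c : ℝ, IsExtHAbscissa 1 (1 / m) lam 1 ρ (1 / m) c →
      Complex.VerticalIntegrable
        (extHIntegrand 1 (1 / m) lam 1 ρ (1 / m) ((u + a * ω) * v) (ω * (u + a * ω))) c ∧
      mTransform ρ m (fun x => ((x ^ (lam - 1) * Real.exp (-(a * x)) : ℝ) : ℂ)) u v ω =
        (ω : ℂ) ^ ((lam : ℂ) - m * ρ - 1) /
            (m * (u + a * ω) ^ (lam : ℂ) * Complex.Gamma ρ) *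
          extH c 1 (1 / m) lam 1 ρ (1 / m) ((u + a * ω) * v) (ω * (u + a * ω)) := by
  have hmi : EqOn (mIntegrand ρ m
      (fun x => ((x ^ (lam - 1) * Real.exp (-(a * x)) : ℝ) : ℂ)) u v ω) _ (Ioi 0) :=
    fun x hx => mIntegrand_rpow_mul_exp ρ m lam a u v hω hx
  refine ⟨?_, exists_isExtHAbscissa hρ hm hlam, fun c hc => ?_⟩
  · exact IntegrableOn.congr_fun
      ((integrableOn_cpow_mul_expAddDiv_mul_cpow hρ m hlam hω hs hv).const_mul _) hmi.symm
      measurableSet_Ioi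
  · obtain ⟨h1, h2⟩ := verticalIntegrable_and_integral_eq hρ hm hω hs hv hsv hc
    rw [mul_comm (ω : ℂ) (u + a * ω)]
    refine ⟨h1, ?_⟩
    have hωc : (ω : ℂ) ≠ 0 := by exact_mod_cast hω.ne'
    rw [mTransform, setIntegral_congr_fun measurableSet_Ioi hmi, integral_const_mul, h2,
      show (lam : ℂ) - m * ρ - 1 = (lam - 1) + -(m * ρ) by ring, Complex.cpow_add _ _ hωc,
      Complex.cpow_neg (u + a * ω)]
    ring

theorem theorem4 (ρ : ℂ) (hρ : 0 < ρ.re) (m : ℕ) (hm : 0 < m) (lam : ℝ) (hlam : 0 < lam)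
    (a : ℝ) (ha : 0 ≤ a) (u v : ℂ) (ω : ℝ) (hω : 0 < ω) (hv : 0 ≤ v.re) :
    -- the transform of `x^{λ-1}`
    (0 < u.re → 0 ≤ (u * v).re →
      IntegrableOn (mIntegrand ρ m (fun x => ((x ^ (lam - 1) : ℝ) : ℂ)) u v ω) (Ioi 0) ∧
      (∃ c : ℝ, IsExtHAbscissa 1 (1 / m) lam 1 ρ (1 / m) c) ∧
      ∀ c : ℝ, IsExtHAbscissa 1 (1 / m) lam 1 ρ (1 / m) c →
        Complex.VerticalIntegrable
          (extHIntegrand 1 (1 / m) lam 1 ρ (1 / m) (u * v) (u * ω)) c ∧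
        mTransform ρ m (fun x => ((x ^ (lam - 1) : ℝ) : ℂ)) u v ω =
          (ω : ℂ) ^ ((lam : ℂ) - m * ρ - 1) * u ^ (-(lam : ℂ)) / (m * Complex.Gamma ρ) *
            extH c 1 (1 / m) lam 1 ρ (1 / m) (u * v) (u * ω)) ∧
    -- the transform of `e^{-ax}`
    (0 < (u + a * ω).re → 0 ≤ ((u + a * ω) * v).re →
      IntegrableOn (mIntegrand ρ m (fun x => ((Real.exp (-(a * x)) : ℝ) : ℂ)) u v ω) (Ioi 0) ∧
      (∃ c : ℝ, IsExtHAbscissa 1 (1 / m) 1 1 ρ (1 / m) c) ∧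
      ∀ c : ℝ, IsExtHAbscissa 1 (1 / m) 1 1 ρ (1 / m) c →
        Complex.VerticalIntegrable
          (extHIntegrand 1 (1 / m) 1 1 ρ (1 / m) ((u + a * ω) * v) (ω * (u + a * ω))) c ∧
        mTransform ρ m (fun x => ((Real.exp (-(a * x)) : ℝ) : ℂ)) u v ω =
          (ω : ℂ) ^ (-(m * ρ)) / (m * (u + a * ω) * Complex.Gamma ρ) *
            extH c 1 (1 / m) 1 1 ρ (1 / m) ((u + a * ω) * v) (ω * (u + a * ω))) ∧
    -- the transform of `x^{λ-1} e^{-ax}`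
    (0 < (u + a * ω).re → 0 ≤ ((u + a * ω) * v).re →
      IntegrableOn
        (mIntegrand ρ m (fun x => ((x ^ (lam - 1) * Real.exp (-(a * x)) : ℝ) : ℂ)) u v ω)
        (Ioi 0) ∧
      (∃ c : ℝ, IsExtHAbscissa 1 (1 / m) lam 1 ρ (1 / m) c) ∧
      ∀ c : ℝ, IsExtHAbscissa 1 (1 / m) lam 1 ρ (1 / m) c →
        Complex.VerticalIntegrable
          (extHIntegrand 1 (1 / m) lam 1 ρ (1 / m) ((u + a * ω) * v) (ω * (u + a * ω))) c ∧
        mTransform ρ m (fun x => ((x ^ (lam - 1) * Real.exp (-(a * x)) : ℝ) : ℂ)) u v ω =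
          (ω : ℂ) ^ ((lam : ℂ) - m * ρ - 1) /
              (m * (u + a * ω) ^ (lam : ℂ) * Complex.Gamma ρ) *
            extH c 1 (1 / m) lam 1 ρ (1 / m) ((u + a * ω) * v) (ω * (u + a * ω))) := by
  refine ⟨fun hs hsv => ?_, fun hs hsv => ?_, fun hs hsv =>
    mTransform_rpow_mul_exp hρ hm hlam a hω hv hs hsv⟩
  -- The pure power is the case `a = 0`; the pure exponential below is the case `λ = 1`.
  · have h := mTransform_rpow_mul_exp hρ hm hlam 0 (u := u) hω hv (by simpa using hs)
      (by simpa using hsv)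
    simp only [zero_mul, neg_zero, Real.exp_zero, mul_one, Complex.ofReal_zero, add_zero] at h
    refine ⟨h.1, h.2.1, fun c hc => ?_⟩
    obtain ⟨h1, h2⟩ := h.2.2 c hc
    rw [mul_comm u (ω : ℂ)]
    refine ⟨h1, ?_⟩
    rw [h2, Complex.cpow_neg u]
    congr 1
    field_simp
  · have h := mTransform_rpow_mul_exp hρ hm one_pos a hω hv hs hsv
    simp only [sub_self, Real.rpow_zero, one_mul, Complex.ofReal_one, Complex.cpow_one] at h
    rwa [show (1 : ℂ) - m * ρ - 1 = -(m * ρ) by ring] at h
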